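/- **Setting.** A *strong proximity lattice* is a bounded distributive lattice $S$ with a relation $\prec$ on $S$ such that: $\prec\circ\prec\,=\,\prec$; $\{a\mid a\prec b\}$ is an ideal for each $b$ and $\{b\mid a\prec b\}$ is a filter for each $a$; $a\prec 0$ implies $a=0$, and $1\prec a$ implies $a=1$; $a\prec b\vee c$ implies $a\le b'\vee c'$ for some $b'\prec b$, $c'\prec c$; and $b\wedge c\prec a$ implies $b'\wedge c'\le a$ for some $b'\succ b$, $c'\succ c$. Its dual $S^{d}$ is the opposite lattice with the relation $\succ$. An *entailment relation* on a set $G$ is a relation $\vdash$ on finite subsets of $G$ with $a\vdash a$; if $A\vdash B$ then $A',A\vdash B,B'$; and if $A\vdash B,a$ and $a,A\vdash B$ then $A\vdash B$. Put $A\prec_L B$ iff $\forall a\in A\,\exists b\in B\,(a\prec b)$ and $A\prec_U B$ iff $\forall b\in B\,\exists a\in A\,(a\prec b)$. A *strong continuous entailment relation* $X=(G,\vdash,\prec)$ is an entailment relation with an idempotent relation $\prec$ on $G$ such that, for all finite $A,B$, $$\exists A'\,(A\prec_U A'\vdash B)\iff\exists B'\,(A\vdash B'\prec_L B);$$ write $A\ll_X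 B$ for this relation. The dual $X^{d}$ is $X$ with $\vdash$ and $\prec$ both reversed. For a finite set $\mathcal U$ of finite sets let $\mathcal U^{*}$ be the set of all unions $\bigcup_{A\in\mathcal U}C_A$ with $\emptyset\ne C_A\subseteq A$. The *cut composition* is: $A\,(s\cdot r)\,C$ iff there is a finite set $\mathcal V$ of finite sets with $A\,r\,B'$ for all $B'\in\mathcal V^{*}$ and $B\,s\,C$ for all $B\in\mathcal V$. A morphism $r\colon X\to Y$ (*join-preserving proximity map*) is a relation between finite subsets such that $A\,r\,B$ implies $(A\cup A')\,r\,(B\cup B')$; $\ll_Y\cdot r=r=r\cdot\ll_X$; and whenever $A\,r\,B$ there is a finite set $\mathcal U$ of finite sets with $A\vdash_X C$ for all $C\in\mathcal U^{*}$ and such that every $A'\in\mathcal U$ satisfies $A'\,r\,\{b\}$ for some $b\in B$. Composition is cut composition, the identity of $X$ is $\ll_X$, and $\cong$ denotes isomorphism for these morphisms. For a strong proximity lattice $S$ let $G=\{\langle p,a\rangle\mid p\in\mathbb Q,\ a\in S\}$. * $\mathfrak V_P(S)=(G,\vdash_{\mathfrak V_P},\prec_{\mathfrak V})$, the strong continuous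 entailment relation of *probabilistic valuations*: $\vdash_{\mathfrak V_P}$ is the least entailment relation with $\vdash\langle p,a\rangle$ ($p<0$); $\langle p,0\rangle\vdash$ ($0<p$); $\langle p,a\rangle\vdash\langle q,b\rangle$ ($q\le p$, $a\le b$); $\langle p,a\rangle\vdash$ ($1<p$); $\vdash\langle p,1\rangle$ ($p<1$); and, whenever $p+q=r+s$, $\langle p,a\rangle,\langle q,b\rangle\vdash\langle r,a\wedge b\rangle,\langle s,a\vee b\rangle$ and $\langle r,a\wedge b\rangle,\langle s,a\vee b\rangle\vdash\langle p,a\rangle,\langle q,b\rangle$. Moreover $\langle p,a\rangle\prec_{\mathfrak V}\langle q,b\rangle$ iff $q<p$ and $a\prec b$. * $\mathfrak C_P(S)=(G,\vdash_{\mathfrak C_P},\prec_{\mathfrak C})$, the strong continuous entailment relation of *probabilistic covaluations*: $\vdash_{\mathfrak C_P}$ is the least entailment relation with $\langle p,a\rangle\vdash$ ($p<0$); $\vdash\langle p,1\rangle$ ($0<p$); $\langle p,a\rangle\vdash\langle q,b\rangle$ ($p\le q$, $a\le b$); $\vdash\langle p,a\rangle$ ($1<p$); $\langle p,0\rangle\vdash$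 ($p<1$); and the same two modular axioms. Moreover $\langle p,a\rangle\prec_{\mathfrak C}\langle q,b\rangle$ iff $p<q$ and $a\prec b$. For finite $A\subseteq G$ put $A^{\neg}=\{\langle 1-p,a\rangle\mid\langle p,a\rangle\in A\}$. **Theorem.** For every strong proximity lattice $S$: 1. $\mathfrak V_P(S)\cong\mathfrak C_P(S)$; mutually inverse isomorphisms are $r\colon\mathfrak V_P(S)\to\mathfrak C_P(S)$ and $s\colon\mathfrak C_P(S)\to\mathfrak V_P(S)$ given by $$A\,r\,B\iff A\ll_{\mathfrak V_P(S)}B^{\neg},\qquad B\,s\,A\iff B\ll_{\mathfrak C_P(S)}A^{\neg}.$$ 2. $\mathfrak V_P(S)^{d}\cong\mathfrak V_P(S^{d})$ and $\mathfrak C_P(S)^{d}\cong\mathfrak C_P(S^{d})$. -/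

import Mathlib

namespace StrongProx

/-! ### Strong proximity lattices -/

/-- A proximity relation between (bounded) distributive lattices: `{a | r a b}` is an ideal for
every `b` and `{b | r a b}` is a filter for every `a`. -/
structure IsProximityRel {S S' : Type*} [DistribLattice S] [BoundedOrder S]
    [DistribLattice S'] [BoundedOrder S'] (r : S → S' → Prop) : Prop where
  bot_left : ∀ b, r ⊥ b
  sup_left : ∀ {a a' b}, r a b → r a' b → r (a ⊔ a') b
  le_left : ∀ {a a' b}, a ≤ a' → r a' b → r a b
  top_right : ∀ a, r a ⊤
  inf_right : ∀ {a b b'}, r a b → r a b' → r a (b ⊓ b')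
  le_right : ∀ {a b b'}, b ≤ b' → r a b → r a b'

/-- A proximity relation is join-preserving if it satisfies the two conditions below. -/
structure IsJoinPreservingRel {S S' : Type*} [DistribLattice S] [BoundedOrder S]
    [DistribLattice S'] [BoundedOrder S'] (r : S → S' → Prop) : Prop where
  bot : ∀ a, r a ⊥ → a = ⊥
  sup : ∀ a b c, r a (b ⊔ c) → ∃ b' c', a ≤ b' ⊔ c' ∧ r b' b ∧ r c' c

/-- The structure of a strong proximity lattice on a (bounded) distributive lattice: an idempotent
join-preserving proximity relation `≺` that also satisfies the two conditions dual to join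
preservation. -/
structure StrongProximityLattice (S : Type*) [DistribLattice S] [BoundedOrder S] where
  /-- the relation `≺` -/
  prec : S → S → Prop
  isProximityRel : IsProximityRel prec
  idem : ∀ a c, prec a c ↔ ∃ b, prec a b ∧ prec b c
  isJoinPreservingRel : IsJoinPreservingRel prec
  top : ∀ a, prec ⊤ a → a = ⊤
  inf : ∀ a b c, prec (b ⊓ c) a → ∃ b' c', prec b b' ∧ prec c c' ∧ b' ⊓ c' ≤ a

/-- The de Groot dual of a strong proximity lattice: the order dual lattice with `≻`. -/
def StrongProximityLattice.dual {S : Type*} [DistribLattice S] [BoundedOrder S]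
    (P : StrongProximityLattice S) : StrongProximityLattice Sᵒᵈ where
  prec a b := P.prec (OrderDual.ofDual b) (OrderDual.ofDual a)
  isProximityRel :=
    { bot_left := fun b => P.isProximityRel.top_right _
      sup_left := fun h h' => P.isProximityRel.inf_right h h'
      le_left := fun h h' => P.isProximityRel.le_right h h'
      top_right := fun a => P.isProximityRel.bot_left _
      inf_right := fun h h' => P.isProximityRel.sup_left h h'
      le_right := fun h h' => P.isProximityRel.le_left h h' }
  idem a c := by
    refine (P.idem _ _).trans ⟨?_, ?_⟩
    · rintro ⟨b, h, h'⟩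
      exact ⟨OrderDual.toDual b, h', h⟩
    · rintro ⟨b, h, h'⟩
      exact ⟨OrderDual.ofDual b, h', h⟩
  isJoinPreservingRel :=
    { bot := fun a h => P.top _ h
      sup := fun a b c h => by
        obtain ⟨b', c', h1, h2, h3⟩ := P.inf _ _ _ h
        exact ⟨OrderDual.toDual b', OrderDual.toDual c', h3, h1, h2⟩ }
  top a h := P.isJoinPreservingRel.bot _ h
  inf a b c h := by
    obtain ⟨b', c', h1, h2, h3⟩ := P.isJoinPreservingRel.sup _ _ _ h
    exact ⟨OrderDual.toDual b', OrderDual.toDual c', h2, h3, h1⟩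

/-! ### Relations between finite subsets and entailment relations -/

section Relations

open scoped Classical

/-- `Star U B` says `B ∈ U*`, where `∅* = {∅}` and
`(U ∪ {A})* = {B ∪ C | B ∈ U*, C an inhabited finite subset of A}`. -/
inductive Star {G : Type*} : Finset (Finset G) → Finset G → Prop
  | empty : Star ∅ ∅
  | insert {U : Finset (Finset G)} {A B C : Finset G} :
      Star U B → C ⊆ A → C.Nonempty → Star (insert A U) (B ∪ C)

/-- Explicitly, `U*` consists of the finite sets `B ⊆ ⋃ U` that meet every member of `U`. -/
theorem star_iff {G : Type*} (U : Finset (Finset G)) (B : Finset G) :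
    Star U B ↔ (∀ b ∈ B, ∃ A ∈ U, b ∈ A) ∧ ∀ A ∈ U, ∃ a ∈ A, a ∈ B := by
  constructor
  · intro h
    induction h with
    | empty => simp
    | @insert U A B C h hC hne ih =>
      obtain ⟨c, hc⟩ := hne
      refine ⟨fun b hb => ?_, fun A' hA' => ?_⟩
      · rcases Finset.mem_union.1 hb with hb | hb
        · obtain ⟨A', hA', h'⟩ := ih.1 b hb
          exact ⟨A', Finset.mem_insert_of_mem hA', h'⟩
        · exact ⟨A, Finset.mem_insert_self _ _, hC hb⟩
      · rcases Finset.mem_insert.1 hA' with rfl | hA'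
        · exact ⟨c, hC hc, Finset.mem_union_right _ hc⟩
        · obtain ⟨a, ha, h'⟩ := ih.2 A' hA'
          exact ⟨a, ha, Finset.mem_union_left _ h'⟩
  · rintro ⟨h1, h2⟩
    induction U using Finset.induction_on generalizing B with
    | empty =>
      have : B = ∅ := Finset.eq_empty_of_forall_notMem fun b hb => by simpa using h1 b hb
      rw [this]
      exact Star.empty
    | @insert A U hA ih =>
      have hB : B = (B.filter fun b => ∃ A' ∈ U, b ∈ A') ∪ (B ∩ A) := by
        ext b
        simp only [Finset.mem_union, Finset.mem_filter, Finset.mem_inter]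
        constructor
        · intro hb
          obtain ⟨A', hA', h'⟩ := h1 b hb
          rcases Finset.mem_insert.1 hA' with rfl | hA'
          · exact Or.inr ⟨hb, h'⟩
          · exact Or.inl ⟨hb, A', hA', h'⟩
        · tauto
      rw [hB]
      refine Star.insert (ih _ ?_ ?_) Finset.inter_subset_right ?_
      · intro b hb
        exact (Finset.mem_filter.1 hb).2
      · intro A' hA'
        obtain ⟨a, ha, h'⟩ := h2 A' (Finset.mem_insert_of_mem hA')
        exact ⟨a, ha, Finset.mem_filter.2 ⟨h', A', hA', ha⟩⟩
      · obtain ⟨a, ha, h'⟩ := h2 A (Finset.mem_insert_self _ _)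
        exact ⟨a, Finset.mem_inter.2 ⟨h', ha⟩⟩

/-- Upper relations between finite subsets. -/
def IsUpper {G G' : Type*} (r : Finset G → Finset G' → Prop) : Prop :=
  ∀ A A' B B', r A B → r (A ∪ A') (B ∪ B')

/-- The cut composition `s · r` (first `r`, then `s`). -/
def cutComp {G G' G'' : Type*} (s : Finset G' → Finset G'' → Prop)
    (r : Finset G → Finset G' → Prop) (A : Finset G) (C : Finset G'') : Prop :=
  ∃ V : Finset (Finset G'), (∀ B', Star V B' → r A B') ∧ ∀ B ∈ V, s B C

/-- The extension of `r` to finite sets of finite sets. -/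
def approxExt {G G' : Type*} (r : Finset G → Finset G' → Prop)
    (U : Finset (Finset G)) (V : Finset (Finset G')) : Prop :=
  ∀ A ∈ U, ∀ B, Star V B → r A B

/-- Scott entailment relations. -/
structure IsEntailmentRel {G : Type*} (ent : Finset G → Finset G → Prop) : Prop where
  refl : ∀ a, ent {a} {a}
  mono : ∀ {A B} A' B', ent A B → ent (A' ∪ A) (B ∪ B')
  cut : ∀ {A B} a, ent A (B ∪ {a}) → ent ({a} ∪ A) B → ent A B

/-- The entailment relation generated by a set of axioms, i.e. the smallest entailment relation
that contains the axioms. -/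
inductive Generated {G : Type*} (ax : Finset G → Finset G → Prop) :
    Finset G → Finset G → Prop
  | ax {A B : Finset G} : ax A B → Generated ax A B
  | refl (a : G) : Generated ax {a} {a}
  | mono {A B : Finset G} (A' B' : Finset G) :
      Generated ax A B → Generated ax (A' ∪ A) (B ∪ B')
  | cut {A B : Finset G} (a : G) :
      Generated ax A (B ∪ {a}) → Generated ax ({a} ∪ A) B → Generated ax A B

theorem Generated.isEntailmentRel {G : Type*} (ax : Finset G → Finset G → Prop) :
    IsEntailmentRel (Generated ax) :=
  ⟨.refl, .mono, .cut⟩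

/-- `A ≺_L B`: every element of `A` is below some element of `B`. -/
def precL {G : Type*} (prec : G → G → Prop) (A B : Finset G) : Prop :=
  ∀ a ∈ A, ∃ b ∈ B, prec a b

/-- `A ≺_U B`: every element of `B` is above some element of `A`. -/
def precU {G : Type*} (prec : G → G → Prop) (A B : Finset G) : Prop :=
  ∀ b ∈ B, ∃ a ∈ A, prec a b

/-! ### Strong continuous entailment relations -/

/-- A strong continuous entailment relation on the set `G` of generators. -/
structure SContEnt (G : Type*) where
  /-- the entailment relation `⊢` -/
  ent : Finset G → Finset G → Prop
  /-- the idempotent relation `≺` -/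
  prec : G → G → Prop
  isEntailmentRel : IsEntailmentRel ent
  idem : ∀ a c, prec a c ↔ ∃ b, prec a b ∧ prec b c
  cont : ∀ A B, (∃ A', precU prec A A' ∧ ent A' B) ↔ ∃ B', ent A B' ∧ precL prec B' B

namespace SContEnt

variable {G G' : Type*}

/-- The relation `≪ = ⊢ ∘ ≺_U` of the associated continuous entailment relation; it is the
identity morphism of `X`. -/
def ll (X : SContEnt G) (A B : Finset G) : Prop :=
  ∃ A', precU X.prec A A' ∧ X.ent A' B

/-- The dual: both the entailment relation and `≺` are reversed. -/
def dual (X : SContEnt G) : SContEnt G where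
  ent A B := X.ent B A
  prec a b := X.prec b a
  isEntailmentRel :=
    { refl := X.isEntailmentRel.refl
      mono := fun {A B} A' B' h => by
        have := X.isEntailmentRel.mono B' A' h
        rwa [Finset.union_comm B', Finset.union_comm A] at this
      cut := fun {A B} a h h' => by
        rw [Finset.union_comm] at h h'
        exact X.isEntailmentRel.cut a h' h }
  idem a c := (X.idem c a).trans ⟨fun ⟨b, h, h'⟩ => ⟨b, h', h⟩, fun ⟨b, h, h'⟩ => ⟨b, h', h⟩⟩
  cont A B := by
    have h := (X.cont B A).symm
    constructor
    · rintro ⟨A', h1, h2⟩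
      obtain ⟨B', h3, h4⟩ := h.1 ⟨A', h2, h1⟩
      exact ⟨B', h4, h3⟩
    · rintro ⟨B', h1, h2⟩
      obtain ⟨A', h3, h4⟩ := h.2 ⟨B', h2, h1⟩
      exact ⟨A', h4, h3⟩

/-- Proximity maps `X → Y`: Karoubi morphisms between the entailment systems `(G, ≪)` and
`(G', ≪')`. -/
structure IsProximityMap (X : SContEnt G) (Y : SContEnt G')
    (r : Finset G → Finset G' → Prop) : Prop where
  upper : IsUpper r
  comp_left : cutComp Y.ll r = r
  comp_right : cutComp r X.ll = r

/-- Join-preserving proximity maps, the morphisms `X → Y` of the category of strong continuous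
entailment relations. -/
structure IsMorphism (X : SContEnt G) (Y : SContEnt G')
    (r : Finset G → Finset G' → Prop) : Prop extends IsProximityMap X Y r where
  joinPreserving : ∀ A B, r A B → ∃ U : Finset (Finset G),
    approxExt X.ent {A} U ∧ ∀ A' ∈ U, ∃ b ∈ B, r A' {b}

/-- `r` and `s` are mutually inverse isomorphisms between `X` and `Y` in the category of strong
continuous entailment relations and join-preserving proximity maps (composition is cut composition,
the identity of `X` is its relation `≪`). -/
structure IsInversePair (X : SContEnt G) (Y : SContEnt G')
    (r : Finset G → Finset G' → Prop) (s : Finset G' → Finset G → Prop) : Prop where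
  hom : IsMorphism X Y r
  inv : IsMorphism Y X s
  hom_inv_id : cutComp s r = X.ll
  inv_hom_id : cutComp r s = Y.ll

/-- `X ≅ Y`. -/
def Isomorphic (X : SContEnt G) (Y : SContEnt G') : Prop :=
  ∃ r s, IsInversePair X Y r s

end SContEnt

/-! ### Generated strong continuous entailment relations -/

theorem Generated.swap {G : Type*} {ax : Finset G → Finset G → Prop} {A B : Finset G}
    (h : Generated ax A B) : Generated (fun A B => ax B A) B A := by
  induction h with
  | ax h => exact .ax h
  | refl a => exact .refl a
  | mono A' B' _ ih =>
    have := Generated.mono B' A' ih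
    rwa [Finset.union_comm B', Finset.union_comm _ A'] at this
  | cut a _ _ ih ih' =>
    rw [Finset.union_comm] at ih ih'
    exact .cut a ih' ih

theorem Generated.weaken {G : Type*} {ax : Finset G → Finset G → Prop} {A B A' B' : Finset G}
    (h : Generated ax A B) (hA : A ⊆ A') (hB : B ⊆ B') : Generated ax A' B' := by
  have := h.mono A' B'
  rwa [Finset.union_eq_left.2 hA, Finset.union_eq_right.2 hB] at this

theorem Generated.cut_many {G : Type*} {ax : Finset G → Finset G → Prop} {A B : Finset G}
    (E : Finset G) (h : Generated ax A (B ∪ E)) (h' : ∀ e ∈ E, Generated ax ({e} ∪ A) B) :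
    Generated ax A B := by
  induction E using Finset.induction_on with
  | empty => simpa using h
  | @insert e E he ih =>
    refine ih ?_ fun e' he' => h' e' (Finset.mem_insert_of_mem he')
    refine Generated.cut e ?_ ((h' e (Finset.mem_insert_self _ _)).weaken subset_rfl
      Finset.subset_union_left)
    exact h.weaken subset_rfl (by intro x; simp)

theorem Generated.interpolate {G : Type*} {ax : Finset G → Finset G → Prop} {prec : G → G → Prop}
    (hax : ∀ C A B, precU prec C A → ax A B → ∃ B', Generated ax C B' ∧ precL prec B' B)
    {A B : Finset G} (h : Generated ax A B) :
    ∀ C, precU prec C A → ∃ B', Generated ax C B' ∧ precL prec B' B := by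
  induction h with
  | ax h => exact fun C hC => hax C _ _ hC h
  | refl a =>
    intro C hC
    obtain ⟨c, hc, hca⟩ := hC a (by simp)
    exact ⟨{c}, (Generated.refl c).weaken (by simpa using hc) subset_rfl, by simpa [precL] using hca⟩
  | mono A' B' _ ih =>
    intro C hC
    obtain ⟨D, h1, h2⟩ := ih C fun b hb => hC b (Finset.mem_union_right _ hb)
    refine ⟨D, h1, fun d hd => ?_⟩
    obtain ⟨b, hb, h⟩ := h2 d hd
    exact ⟨b, Finset.mem_union_left _ hb, h⟩
  | @cut A B a _ _ ih ih' =>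
    intro C hC
    obtain ⟨D, h1, h2⟩ := ih C hC
    have key : ∀ x, prec x a → ∃ B', Generated ax ({x} ∪ C) B' ∧ precL prec B' B := by
      intro x hx
      refine ih' _ fun b hb => ?_
      rcases Finset.mem_union.1 hb with hb | hb
      · rw [Finset.mem_singleton.1 hb]
        exact ⟨x, by simp, hx⟩
      · obtain ⟨c, hc, h⟩ := hC b hb
        exact ⟨c, Finset.mem_union_right _ hc, h⟩
    have key' : ∀ x, ∃ B', (prec x a → Generated ax ({x} ∪ C) B') ∧ precL prec B' B := by
      intro x
      by_cases hx : prec x a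
      · obtain ⟨B', h, h'⟩ := key x hx
        exact ⟨B', fun _ => h, h'⟩
      · exact ⟨∅, fun h => absurd h hx, by simp [precL]⟩
    choose f hf hf' using key'
    set D1 := D.filter fun d => ∃ b ∈ B, prec d b with hD1
    set D2 := D.filter fun d => prec d a with hD2
    refine ⟨D1 ∪ D2.biUnion f, Generated.cut_many D2 (h1.weaken subset_rfl ?_) ?_, ?_⟩
    · intro d hd
      obtain ⟨b, hb, h⟩ := h2 d hd
      rcases Finset.mem_union.1 hb with hb | hb
      · exact Finset.mem_union_left _ (Finset.mem_union_left _ (Finset.mem_filter.2 ⟨hd, b, hb, h⟩))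
      · rw [Finset.mem_singleton.1 hb] at h
        exact Finset.mem_union_right _ (Finset.mem_filter.2 ⟨hd, h⟩)
    · intro e he
      refine (hf e (Finset.mem_filter.1 he).2).weaken subset_rfl ?_
      exact (Finset.subset_biUnion_of_mem f he).trans Finset.subset_union_right
    · intro d hd
      rcases Finset.mem_union.1 hd with hd | hd
      · exact (Finset.mem_filter.1 hd).2
      · obtain ⟨e, _, h⟩ := Finset.mem_biUnion.1 hd
        exact hf' e d h

/-- A set of axioms and an idempotent relation that are compatible in the sense of `hU` and `hL`
generate a strong continuous entailment relation. -/
def SContEnt.generate {G : Type*} (ax : Finset G → Finset G → Prop) (prec : G → G → Prop)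
    (idem : ∀ a c, prec a c ↔ ∃ b, prec a b ∧ prec b c)
    (hU : ∀ C A B, precU prec C A → ax A B → ∃ B', Generated ax C B' ∧ precL prec B' B)
    (hL : ∀ A B C, ax A B → precL prec B C → ∃ A', precU prec A A' ∧ Generated ax A' C) :
    SContEnt G where
  ent := Generated ax
  prec := prec
  isEntailmentRel := Generated.isEntailmentRel ax
  idem := idem
  cont A B := by
    constructor
    · rintro ⟨A', h1, h2⟩
      exact h2.interpolate hU A h1
    · rintro ⟨B', h1, h2⟩
      have := h1.swap.interpolate (prec := fun a b => prec b a) (fun C D E h h' => by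
        obtain ⟨F, h3, h4⟩ := hL E D C h' h
        exact ⟨F, h4.swap, h3⟩) B h2
      obtain ⟨A', h3, h4⟩ := this
      exact ⟨A', h4, h3.swap⟩

/-! ### Probabilistic valuations and covaluations -/

/-- The generators `⟨p, a⟩` with `p` rational and `a ∈ S`. -/
@[ext]
structure ValGen (S : Type*) where
  /-- the rational component -/
  rat : ℚ
  /-- the lattice component -/
  elt : S

/-- The image of a finite set of generators under `⟨p, a⟩ ↦ ⟨1 - p, a⟩`. -/
noncomputable def reflect {S : Type*} (A : Finset (ValGen S)) : Finset (ValGen S) :=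
  A.image fun g => ⟨1 - g.rat, g.elt⟩

section Axioms

variable {S : Type*} [DistribLattice S] [BoundedOrder S]

/-- The axioms of the space of valuations; `⟨p, a⟩` stands for `p < μ(a)`. -/
inductive ValuationAx : Finset (ValGen S) → Finset (ValGen S) → Prop
  | neg (p : ℚ) (a : S) : p < 0 → ValuationAx ∅ {⟨p, a⟩}
  | bot (p : ℚ) : 0 < p → ValuationAx {⟨p, ⊥⟩} ∅
  | mono (p q : ℚ) (a b : S) : q ≤ p → a ≤ b → ValuationAx {⟨p, a⟩} {⟨q, b⟩}
  | modular₁ (p q r s : ℚ) (a b : S) : p + q = r + s →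
      ValuationAx {⟨p, a⟩, ⟨q, b⟩} {⟨r, a ⊓ b⟩, ⟨s, a ⊔ b⟩}
  | modular₂ (p q r s : ℚ) (a b : S) : p + q = r + s →
      ValuationAx {⟨r, a ⊓ b⟩, ⟨s, a ⊔ b⟩} {⟨p, a⟩, ⟨q, b⟩}

/-- The axioms of the space of probabilistic valuations. -/
inductive ProbValuationAx : Finset (ValGen S) → Finset (ValGen S) → Prop
  | val {A B : Finset (ValGen S)} : ValuationAx A B → ProbValuationAx A B
  | one_lt (p : ℚ) (a : S) : 1 < p → ProbValuationAx {⟨p, a⟩} ∅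
  | lt_one (p : ℚ) : p < 1 → ProbValuationAx ∅ {⟨p, ⊤⟩}

/-- The axioms of the space of covaluations; `⟨p, a⟩` stands for `ν(a) < p`. -/
inductive CovaluationAx : Finset (ValGen S) → Finset (ValGen S) → Prop
  | neg (p : ℚ) (a : S) : p < 0 → CovaluationAx {⟨p, a⟩} ∅
  | top (p : ℚ) : 0 < p → CovaluationAx ∅ {⟨p, ⊤⟩}
  | mono (p q : ℚ) (a b : S) : p ≤ q → a ≤ b → CovaluationAx {⟨p, a⟩} {⟨q, b⟩}
  | modular₁ (p q r s : ℚ) (a b : S) : p + q = r + s →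
      CovaluationAx {⟨p, a⟩, ⟨q, b⟩} {⟨r, a ⊓ b⟩, ⟨s, a ⊔ b⟩}
  | modular₂ (p q r s : ℚ) (a b : S) : p + q = r + s →
      CovaluationAx {⟨r, a ⊓ b⟩, ⟨s, a ⊔ b⟩} {⟨p, a⟩, ⟨q, b⟩}

/-- The axioms of the space of probabilistic covaluations. -/
inductive ProbCovaluationAx : Finset (ValGen S) → Finset (ValGen S) → Prop
  | coval {A B : Finset (ValGen S)} : CovaluationAx A B → ProbCovaluationAx A B
  | one_lt (p : ℚ) (a : S) : 1 < p → ProbCovaluationAx ∅ {⟨p, a⟩}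
  | lt_one (p : ℚ) : p < 1 → ProbCovaluationAx {⟨p, ⊥⟩} ∅

/-- The idempotent relation for valuations. -/
def valPrec (P : StrongProximityLattice S) (g h : ValGen S) : Prop :=
  h.rat < g.rat ∧ P.prec g.elt h.elt

/-- The idempotent relation for covaluations. -/
def covalPrec (P : StrongProximityLattice S) (g h : ValGen S) : Prop :=
  g.rat < h.rat ∧ P.prec g.elt h.elt

theorem valPrec_idem (P : StrongProximityLattice S) (g h : ValGen S) :
    valPrec P g h ↔ ∃ k, valPrec P g k ∧ valPrec P k h := by
  constructor
  · rintro ⟨h1, h2⟩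
    obtain ⟨b, h3, h4⟩ := (P.idem _ _).1 h2
    obtain ⟨p, h5, h6⟩ := exists_between h1
    exact ⟨⟨p, b⟩, ⟨h6, h3⟩, ⟨h5, h4⟩⟩
  · rintro ⟨k, h1, h2⟩
    exact ⟨h2.1.trans h1.1, (P.idem _ _).2 ⟨_, h1.2, h2.2⟩⟩

theorem covalPrec_idem (P : StrongProximityLattice S) (g h : ValGen S) :
    covalPrec P g h ↔ ∃ k, covalPrec P g k ∧ covalPrec P k h := by
  constructor
  · rintro ⟨h1, h2⟩
    obtain ⟨b, h3, h4⟩ := (P.idem _ _).1 h2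
    obtain ⟨p, h5, h6⟩ := exists_between h1
    exact ⟨⟨p, b⟩, ⟨h5, h3⟩, ⟨h6, h4⟩⟩
  · rintro ⟨k, h1, h2⟩
    exact ⟨h1.1.trans h2.1, (P.idem _ _).2 ⟨_, h1.2, h2.2⟩⟩

/-- If `a ⊓ b ≺ c` and `a ⊔ b ≺ d`, then `a ≺ a'` and `b ≺ b'` for some `a'`, `b'` with
`a' ⊓ b' ≤ c` and `a' ⊔ b' ≤ d`. -/
theorem StrongProximityLattice.enlarge (P : StrongProximityLattice S) {a b c d : S}
    (h : P.prec (a ⊓ b) c) (h' : P.prec (a ⊔ b) d) :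
    ∃ a' b', P.prec a a' ∧ P.prec b b' ∧ a' ⊓ b' ≤ c ∧ a' ⊔ b' ≤ d := by
  obtain ⟨a', b', h1, h2, h3⟩ := P.inf _ _ _ h
  have H := P.isProximityRel
  exact ⟨a' ⊓ d, b' ⊓ d, H.inf_right h1 (H.le_left le_sup_left h'),
    H.inf_right h2 (H.le_left le_sup_right h'),
    (inf_le_inf inf_le_left inf_le_left).trans h3, sup_le inf_le_right inf_le_right⟩

/-- If `c ≺ a ⊓ b` and `d ≺ a ⊔ b`, then `a' ≺ a` and `b' ≺ b` for some `a'`, `b'` with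
`c ≤ a' ⊓ b'` and `d ≤ a' ⊔ b'`. -/
theorem StrongProximityLattice.shrink (P : StrongProximityLattice S) {a b c d : S}
    (h : P.prec c (a ⊓ b)) (h' : P.prec d (a ⊔ b)) :
    ∃ a' b', P.prec a' a ∧ P.prec b' b ∧ c ≤ a' ⊓ b' ∧ d ≤ a' ⊔ b' := by
  obtain ⟨a', b', h1, h2, h3⟩ := P.isJoinPreservingRel.sup _ _ _ h'
  have H := P.isProximityRel
  exact ⟨a' ⊔ c, b' ⊔ c, H.sup_left h2 (H.le_right inf_le_left h),
    H.sup_left h3 (H.le_right inf_le_right h), le_inf le_sup_right le_sup_right,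
    h1.trans (sup_le_sup le_sup_left le_sup_left)⟩

theorem Generated.of_mem {G : Type*} {ax : Finset G → Finset G → Prop} {C E B : Finset G}
    (hE : ∀ e ∈ E, ∃ c ∈ C, Generated ax {c} {e}) (h : Generated ax E B) : Generated ax C B := by
  have key : Generated ax (E ∪ C) B := h.weaken Finset.subset_union_left subset_rfl
  clear h
  induction E using Finset.induction_on with
  | empty => simpa using key
  | @insert e E he ih =>
    refine ih (fun e' he' => hE e' (Finset.mem_insert_of_mem he')) (Generated.cut e ?_ ?_)
    · obtain ⟨c, hc, h⟩ := hE e (Finset.mem_insert_self _ _)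
      exact h.weaken (by simp [hc]) Finset.subset_union_right
    · exact key.weaken (by intro x; simp) subset_rfl

theorem Generated.to_mem {G : Type*} {ax : Finset G → Finset G → Prop} {C E A : Finset G}
    (hE : ∀ e ∈ E, ∃ c ∈ C, Generated ax {e} {c}) (h : Generated ax A E) : Generated ax A C :=
  (Generated.of_mem (fun e he => by
    obtain ⟨c, hc, h⟩ := hE e he
    exact ⟨c, hc, h.swap⟩) h.swap).swap

theorem probValuation_modular₁ (P : StrongProximityLattice S) {p q r s : ℚ} {a b : S}
    {C : Finset (ValGen S)} (hpq : p + q = r + s)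
    (hC : precU (valPrec P) C {⟨p, a⟩, ⟨q, b⟩}) :
    ∃ B', Generated ProbValuationAx C B' ∧ precL (valPrec P) B' {⟨r, a ⊓ b⟩, ⟨s, a ⊔ b⟩} := by
  have H := P.isProximityRel
  obtain ⟨⟨p', a'⟩, hp, h1, h2⟩ := hC ⟨p, a⟩ (by simp)
  obtain ⟨⟨q', b'⟩, hq, h3, h4⟩ := hC ⟨q, b⟩ (by simp)
  simp only at h1 h2 h3 h4
  refine ⟨{⟨r + (p' - p + q' - q) / 2, a' ⊓ b'⟩, ⟨s + (p' - p + q' - q) / 2, a' ⊔ b'⟩},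
    (Generated.ax (.val (.modular₁ p' q' _ _ a' b' (by linarith)))).weaken ?_ subset_rfl, ?_⟩
  · intro x
    simp only [Finset.mem_insert, Finset.mem_singleton]
    rintro (rfl | rfl) <;> assumption
  · intro x
    simp only [Finset.mem_insert, Finset.mem_singleton]
    rintro (rfl | rfl)
    · exact ⟨_, Or.inl rfl, by simp only; linarith,
        H.inf_right (H.le_left inf_le_left h2) (H.le_left inf_le_right h4)⟩
    · exact ⟨_, Or.inr rfl, by simp only; linarith,
        H.sup_left (H.le_right le_sup_left h2) (H.le_right le_sup_right h4)⟩

theorem probValuation_modular₂ (P : StrongProximityLattice S) {p q r s : ℚ} {a b : S}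
    {C : Finset (ValGen S)} (hpq : p + q = r + s)
    (hC : precU (valPrec P) C {⟨r, a ⊓ b⟩, ⟨s, a ⊔ b⟩}) :
    ∃ B', Generated ProbValuationAx C B' ∧ precL (valPrec P) B' {⟨p, a⟩, ⟨q, b⟩} := by
  obtain ⟨⟨r', c⟩, hr, h1, h2⟩ := hC ⟨r, a ⊓ b⟩ (by simp)
  obtain ⟨⟨s', d⟩, hs, h3, h4⟩ := hC ⟨s, a ⊔ b⟩ (by simp)
  simp only at h1 h2 h3 h4
  obtain ⟨a', b', ha, hb, hc, hd⟩ := P.shrink h2 h4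
  refine ⟨{⟨p + (r' - r + s' - s) / 2, a'⟩, ⟨q + (r' - r + s' - s) / 2, b'⟩},
    Generated.of_mem ?_ (Generated.ax (.val (.modular₂ _ _ r' s' a' b' (by linarith)))), ?_⟩
  · intro x
    simp only [Finset.mem_insert, Finset.mem_singleton]
    rintro (rfl | rfl)
    · exact ⟨_, hr, .ax (.val (.mono _ _ _ _ le_rfl hc))⟩
    · exact ⟨_, hs, .ax (.val (.mono _ _ _ _ le_rfl hd))⟩
  · intro x
    simp only [Finset.mem_insert, Finset.mem_singleton]
    rintro (rfl | rfl)
    · exact ⟨_, Or.inl rfl, by simp only; linarith, ha⟩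
    · exact ⟨_, Or.inr rfl, by simp only; linarith, hb⟩

theorem probValuation_modular₁' (P : StrongProximityLattice S) {p q r s : ℚ} {a b : S}
    {C : Finset (ValGen S)} (hpq : p + q = r + s)
    (hC : precL (valPrec P) {⟨r, a ⊓ b⟩, ⟨s, a ⊔ b⟩} C) :
    ∃ A', precU (valPrec P) {⟨p, a⟩, ⟨q, b⟩} A' ∧ Generated ProbValuationAx A' C := by
  obtain ⟨⟨r', c⟩, hr, h1, h2⟩ := hC ⟨r, a ⊓ b⟩ (by simp)
  obtain ⟨⟨s', d⟩, hs, h3, h4⟩ := hC ⟨s, a ⊔ b⟩ (by simp)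
  simp only at h1 h2 h3 h4
  obtain ⟨a', b', ha, hb, hc, hd⟩ := P.enlarge h2 h4
  refine ⟨{⟨p + (r' - r + s' - s) / 2, a'⟩, ⟨q + (r' - r + s' - s) / 2, b'⟩}, ?_,
    Generated.to_mem ?_ (Generated.ax (.val (.modular₁ _ _ r' s' a' b' (by linarith))))⟩
  · intro x
    simp only [Finset.mem_insert, Finset.mem_singleton]
    rintro (rfl | rfl)
    · exact ⟨_, Or.inl rfl, by simp only; linarith, ha⟩
    · exact ⟨_, Or.inr rfl, by simp only; linarith, hb⟩
  · intro x
    simp only [Finset.mem_insert, Finset.mem_singleton]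
    rintro (rfl | rfl)
    · exact ⟨_, hr, .ax (.val (.mono _ _ _ _ le_rfl hc))⟩
    · exact ⟨_, hs, .ax (.val (.mono _ _ _ _ le_rfl hd))⟩

theorem probValuation_modular₂' (P : StrongProximityLattice S) {p q r s : ℚ} {a b : S}
    {C : Finset (ValGen S)} (hpq : p + q = r + s)
    (hC : precL (valPrec P) {⟨p, a⟩, ⟨q, b⟩} C) :
    ∃ A', precU (valPrec P) {⟨r, a ⊓ b⟩, ⟨s, a ⊔ b⟩} A' ∧ Generated ProbValuationAx A' C := by
  have H := P.isProximityRel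
  obtain ⟨⟨p', a'⟩, hp, h1, h2⟩ := hC ⟨p, a⟩ (by simp)
  obtain ⟨⟨q', b'⟩, hq, h3, h4⟩ := hC ⟨q, b⟩ (by simp)
  simp only at h1 h2 h3 h4
  refine ⟨{⟨r + (p' - p + q' - q) / 2, a' ⊓ b'⟩, ⟨s + (p' - p + q' - q) / 2, a' ⊔ b'⟩}, ?_,
    (Generated.ax (.val (.modular₂ p' q' _ _ a' b' (by linarith)))).weaken subset_rfl ?_⟩
  · intro x
    simp only [Finset.mem_insert, Finset.mem_singleton]
    rintro (rfl | rfl)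
    · exact ⟨_, Or.inl rfl, by simp only; linarith,
        H.inf_right (H.le_left inf_le_left h2) (H.le_left inf_le_right h4)⟩
    · exact ⟨_, Or.inr rfl, by simp only; linarith,
        H.sup_left (H.le_right le_sup_left h2) (H.le_right le_sup_right h4)⟩
  · intro x
    simp only [Finset.mem_insert, Finset.mem_singleton]
    rintro (rfl | rfl) <;> assumption

theorem probCovaluation_modular₁ (P : StrongProximityLattice S) {p q r s : ℚ} {a b : S}
    {C : Finset (ValGen S)} (hpq : p + q = r + s)
    (hC : precU (covalPrec P) C {⟨p, a⟩, ⟨q, b⟩}) :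
    ∃ B', Generated ProbCovaluationAx C B' ∧ precL (covalPrec P) B' {⟨r, a ⊓ b⟩, ⟨s, a ⊔ b⟩} := by
  have H := P.isProximityRel
  obtain ⟨⟨p', a'⟩, hp, h1, h2⟩ := hC ⟨p, a⟩ (by simp)
  obtain ⟨⟨q', b'⟩, hq, h3, h4⟩ := hC ⟨q, b⟩ (by simp)
  simp only at h1 h2 h3 h4
  refine ⟨{⟨r + (p' - p + q' - q) / 2, a' ⊓ b'⟩, ⟨s + (p' - p + q' - q) / 2, a' ⊔ b'⟩},
    (Generated.ax (.coval (.modular₁ p' q' _ _ a' b' (by linarith)))).weaken ?_ subset_rfl, ?_⟩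
  · intro x
    simp only [Finset.mem_insert, Finset.mem_singleton]
    rintro (rfl | rfl) <;> assumption
  · intro x
    simp only [Finset.mem_insert, Finset.mem_singleton]
    rintro (rfl | rfl)
    · exact ⟨_, Or.inl rfl, by simp only; linarith,
        H.inf_right (H.le_left inf_le_left h2) (H.le_left inf_le_right h4)⟩
    · exact ⟨_, Or.inr rfl, by simp only; linarith,
        H.sup_left (H.le_right le_sup_left h2) (H.le_right le_sup_right h4)⟩

theorem probCovaluation_modular₂ (P : StrongProximityLattice S) {p q r s : ℚ} {a b : S}
    {C : Finset (ValGen S)} (hpq : p + q = r + s)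
    (hC : precU (covalPrec P) C {⟨r, a ⊓ b⟩, ⟨s, a ⊔ b⟩}) :
    ∃ B', Generated ProbCovaluationAx C B' ∧ precL (covalPrec P) B' {⟨p, a⟩, ⟨q, b⟩} := by
  obtain ⟨⟨r', c⟩, hr, h1, h2⟩ := hC ⟨r, a ⊓ b⟩ (by simp)
  obtain ⟨⟨s', d⟩, hs, h3, h4⟩ := hC ⟨s, a ⊔ b⟩ (by simp)
  simp only at h1 h2 h3 h4
  obtain ⟨a', b', ha, hb, hc, hd⟩ := P.shrink h2 h4
  refine ⟨{⟨p + (r' - r + s' - s) / 2, a'⟩, ⟨q + (r' - r + s' - s) / 2, b'⟩},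
    Generated.of_mem ?_ (Generated.ax (.coval (.modular₂ _ _ r' s' a' b' (by linarith)))), ?_⟩
  · intro x
    simp only [Finset.mem_insert, Finset.mem_singleton]
    rintro (rfl | rfl)
    · exact ⟨_, hr, .ax (.coval (.mono _ _ _ _ le_rfl hc))⟩
    · exact ⟨_, hs, .ax (.coval (.mono _ _ _ _ le_rfl hd))⟩
  · intro x
    simp only [Finset.mem_insert, Finset.mem_singleton]
    rintro (rfl | rfl)
    · exact ⟨_, Or.inl rfl, by simp only; linarith, ha⟩
    · exact ⟨_, Or.inr rfl, by simp only; linarith, hb⟩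

theorem probCovaluation_modular₁' (P : StrongProximityLattice S) {p q r s : ℚ} {a b : S}
    {C : Finset (ValGen S)} (hpq : p + q = r + s)
    (hC : precL (covalPrec P) {⟨r, a ⊓ b⟩, ⟨s, a ⊔ b⟩} C) :
    ∃ A', precU (covalPrec P) {⟨p, a⟩, ⟨q, b⟩} A' ∧ Generated ProbCovaluationAx A' C := by
  obtain ⟨⟨r', c⟩, hr, h1, h2⟩ := hC ⟨r, a ⊓ b⟩ (by simp)
  obtain ⟨⟨s', d⟩, hs, h3, h4⟩ := hC ⟨s, a ⊔ b⟩ (by simp)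
  simp only at h1 h2 h3 h4
  obtain ⟨a', b', ha, hb, hc, hd⟩ := P.enlarge h2 h4
  refine ⟨{⟨p + (r' - r + s' - s) / 2, a'⟩, ⟨q + (r' - r + s' - s) / 2, b'⟩}, ?_,
    Generated.to_mem ?_ (Generated.ax (.coval (.modular₁ _ _ r' s' a' b' (by linarith))))⟩
  · intro x
    simp only [Finset.mem_insert, Finset.mem_singleton]
    rintro (rfl | rfl)
    · exact ⟨_, Or.inl rfl, by simp only; linarith, ha⟩
    · exact ⟨_, Or.inr rfl, by simp only; linarith, hb⟩
  · intro x
    simp only [Finset.mem_insert, Finset.mem_singleton]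
    rintro (rfl | rfl)
    · exact ⟨_, hr, .ax (.coval (.mono _ _ _ _ le_rfl hc))⟩
    · exact ⟨_, hs, .ax (.coval (.mono _ _ _ _ le_rfl hd))⟩

theorem probCovaluation_modular₂' (P : StrongProximityLattice S) {p q r s : ℚ} {a b : S}
    {C : Finset (ValGen S)} (hpq : p + q = r + s)
    (hC : precL (covalPrec P) {⟨p, a⟩, ⟨q, b⟩} C) :
    ∃ A', precU (covalPrec P) {⟨r, a ⊓ b⟩, ⟨s, a ⊔ b⟩} A' ∧ Generated ProbCovaluationAx A' C := by
  have H := P.isProximityRel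
  obtain ⟨⟨p', a'⟩, hp, h1, h2⟩ := hC ⟨p, a⟩ (by simp)
  obtain ⟨⟨q', b'⟩, hq, h3, h4⟩ := hC ⟨q, b⟩ (by simp)
  simp only at h1 h2 h3 h4
  refine ⟨{⟨r + (p' - p + q' - q) / 2, a' ⊓ b'⟩, ⟨s + (p' - p + q' - q) / 2, a' ⊔ b'⟩}, ?_,
    (Generated.ax (.coval (.modular₂ p' q' _ _ a' b' (by linarith)))).weaken subset_rfl ?_⟩
  · intro x
    simp only [Finset.mem_insert, Finset.mem_singleton]
    rintro (rfl | rfl)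
    · exact ⟨_, Or.inl rfl, by simp only; linarith,
        H.inf_right (H.le_left inf_le_left h2) (H.le_left inf_le_right h4)⟩
    · exact ⟨_, Or.inr rfl, by simp only; linarith,
        H.sup_left (H.le_right le_sup_left h2) (H.le_right le_sup_right h4)⟩
  · intro x
    simp only [Finset.mem_insert, Finset.mem_singleton]
    rintro (rfl | rfl) <;> assumption

/-- The strong continuous entailment relation of probabilistic valuations of `P`. -/
def probValuation (P : StrongProximityLattice S) : SContEnt (ValGen S) :=
  .generate ProbValuationAx (valPrec P) (valPrec_idem P)
    (by
      intro C A B hC h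
      have H := P.isProximityRel
      cases h with
      | val h =>
        cases h with
        | neg p a hp =>
          obtain ⟨q, h1, h2⟩ := exists_between hp
          exact ⟨{⟨q, ⊥⟩}, (Generated.ax (.val (.neg q ⊥ h2))).weaken (by simp) subset_rfl,
            fun x hx => ⟨_, Finset.mem_singleton_self _, by
              rw [Finset.mem_singleton.1 hx]; exact ⟨h1, H.bot_left _⟩⟩⟩
        | bot p hp =>
          obtain ⟨⟨q, b⟩, hq, h1, h2⟩ := hC _ (Finset.mem_singleton_self _)
          obtain rfl : b = ⊥ := P.isJoinPreservingRel.bot _ h2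
          exact ⟨∅, (Generated.ax (.val (.bot q (hp.trans h1)))).weaken (by simpa using hq)
            subset_rfl, by simp [precL]⟩
        | mono p q a b hpq hab =>
          obtain ⟨⟨p', a'⟩, hp, h1, h2⟩ := hC _ (Finset.mem_singleton_self _)
          exact ⟨{⟨p', a'⟩}, (Generated.refl _).weaken (by simpa using hp) subset_rfl,
            fun x hx => ⟨_, Finset.mem_singleton_self _, by
              rw [Finset.mem_singleton.1 hx]
              exact ⟨hpq.trans_lt h1, H.le_right hab h2⟩⟩⟩
        | modular₁ p q r s a b hpq => exact probValuation_modular₁ P hpq hC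
        | modular₂ p q r s a b hpq => exact probValuation_modular₂ P hpq hC
      | one_lt p a hp =>
        obtain ⟨⟨q, b⟩, hq, h1, h2⟩ := hC _ (Finset.mem_singleton_self _)
        exact ⟨∅, (Generated.ax (.one_lt q b (hp.trans h1))).weaken (by simpa using hq)
          subset_rfl, by simp [precL]⟩
      | lt_one p hp =>
        obtain ⟨q, h1, h2⟩ := exists_between hp
        exact ⟨{⟨q, ⊤⟩}, (Generated.ax (.lt_one q h2)).weaken (by simp) subset_rfl,
          fun x hx => ⟨_, Finset.mem_singleton_self _, by
            rw [Finset.mem_singleton.1 hx]; exact ⟨h1, H.top_right _⟩⟩⟩)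
    (by
      intro A B C h hC
      have H := P.isProximityRel
      cases h with
      | val h =>
        cases h with
        | neg p a hp =>
          obtain ⟨⟨q, b⟩, hq, h1, h2⟩ := hC _ (Finset.mem_singleton_self _)
          exact ⟨∅, by simp [precU], (Generated.ax (.val (.neg q b (h1.trans hp)))).weaken
            subset_rfl (by simpa using hq)⟩
        | bot p hp =>
          obtain ⟨q, h1, h2⟩ := exists_between hp
          exact ⟨{⟨q, ⊥⟩}, fun x hx => ⟨_, Finset.mem_singleton_self _, by
              rw [Finset.mem_singleton.1 hx]; exact ⟨h2, H.bot_left _⟩⟩,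
            (Generated.ax (.val (.bot q h1))).weaken subset_rfl (by simp)⟩
        | mono p q a b hpq hab =>
          obtain ⟨⟨p', a'⟩, hp, h1, h2⟩ := hC _ (Finset.mem_singleton_self _)
          exact ⟨{⟨p', a'⟩}, fun x hx => ⟨_, Finset.mem_singleton_self _, by
              rw [Finset.mem_singleton.1 hx]
              exact ⟨h1.trans_le hpq, H.le_left hab h2⟩⟩,
            (Generated.refl _).weaken subset_rfl (by simpa using hp)⟩
        | modular₁ p q r s a b hpq => exact probValuation_modular₁' P hpq hC
        | modular₂ p q r s a b hpq => exact probValuation_modular₂' P hpq hC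
      | one_lt p a hp =>
        obtain ⟨q, h1, h2⟩ := exists_between hp
        exact ⟨{⟨q, ⊤⟩}, fun x hx => ⟨_, Finset.mem_singleton_self _, by
            rw [Finset.mem_singleton.1 hx]; exact ⟨h2, H.top_right _⟩⟩,
          (Generated.ax (.one_lt q ⊤ h1)).weaken subset_rfl (by simp)⟩
      | lt_one p hp =>
        obtain ⟨⟨q, b⟩, hq, h1, h2⟩ := hC _ (Finset.mem_singleton_self _)
        obtain rfl : b = ⊤ := P.top _ h2
        exact ⟨∅, by simp [precU], (Generated.ax (.lt_one q (h1.trans hp))).weaken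
          subset_rfl (by simpa using hq)⟩)

/-- The strong continuous entailment relation of probabilistic covaluations of `P`. -/
def probCovaluation (P : StrongProximityLattice S) : SContEnt (ValGen S) :=
  .generate ProbCovaluationAx (covalPrec P) (covalPrec_idem P)
    (by
      intro C A B hC h
      have H := P.isProximityRel
      cases h with
      | coval h =>
        cases h with
        | neg p a hp =>
          obtain ⟨⟨q, b⟩, hq, h1, h2⟩ := hC _ (Finset.mem_singleton_self _)
          exact ⟨∅, (Generated.ax (.coval (.neg q b (h1.trans hp)))).weaken (by simpa using hq)
            subset_rfl, by simp [precL]⟩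
        | top p hp =>
          obtain ⟨q, h1, h2⟩ := exists_between hp
          exact ⟨{⟨q, ⊤⟩}, (Generated.ax (.coval (.top q h1))).weaken (by simp) subset_rfl,
            fun x hx => ⟨_, Finset.mem_singleton_self _, by
              rw [Finset.mem_singleton.1 hx]; exact ⟨h2, H.top_right _⟩⟩⟩
        | mono p q a b hpq hab =>
          obtain ⟨⟨p', a'⟩, hp, h1, h2⟩ := hC _ (Finset.mem_singleton_self _)
          exact ⟨{⟨p', a'⟩}, (Generated.refl _).weaken (by simpa using hp) subset_rfl,
            fun x hx => ⟨_, Finset.mem_singleton_self _, by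
              rw [Finset.mem_singleton.1 hx]
              exact ⟨h1.trans_le hpq, H.le_right hab h2⟩⟩⟩
        | modular₁ p q r s a b hpq => exact probCovaluation_modular₁ P hpq hC
        | modular₂ p q r s a b hpq => exact probCovaluation_modular₂ P hpq hC
      | one_lt p a hp =>
        obtain ⟨q, h1, h2⟩ := exists_between hp
        exact ⟨{⟨q, ⊥⟩}, (Generated.ax (.one_lt q ⊥ h1)).weaken (by simp) subset_rfl,
          fun x hx => ⟨_, Finset.mem_singleton_self _, by
            rw [Finset.mem_singleton.1 hx]; exact ⟨h2, H.bot_left _⟩⟩⟩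
      | lt_one p hp =>
        obtain ⟨⟨q, b⟩, hq, h1, h2⟩ := hC _ (Finset.mem_singleton_self _)
        obtain rfl : b = ⊥ := P.isJoinPreservingRel.bot _ h2
        exact ⟨∅, (Generated.ax (.lt_one q (h1.trans hp))).weaken (by simpa using hq)
          subset_rfl, by simp [precL]⟩)
    (by
      intro A B C h hC
      have H := P.isProximityRel
      cases h with
      | coval h =>
        cases h with
        | neg p a hp =>
          obtain ⟨q, h1, h2⟩ := exists_between hp
          exact ⟨{⟨q, ⊤⟩}, fun x hx => ⟨_, Finset.mem_singleton_self _, by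
              rw [Finset.mem_singleton.1 hx]; exact ⟨h1, H.top_right _⟩⟩,
            (Generated.ax (.coval (.neg q ⊤ h2))).weaken subset_rfl (by simp)⟩
        | top p hp =>
          obtain ⟨⟨q, b⟩, hq, h1, h2⟩ := hC _ (Finset.mem_singleton_self _)
          obtain rfl : b = ⊤ := P.top _ h2
          exact ⟨∅, by simp [precU], (Generated.ax (.coval (.top q (hp.trans h1)))).weaken
            subset_rfl (by simpa using hq)⟩
        | mono p q a b hpq hab =>
          obtain ⟨⟨p', a'⟩, hp, h1, h2⟩ := hC _ (Finset.mem_singleton_self _)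
          exact ⟨{⟨p', a'⟩}, fun x hx => ⟨_, Finset.mem_singleton_self _, by
              rw [Finset.mem_singleton.1 hx]
              exact ⟨hpq.trans_lt h1, H.le_left hab h2⟩⟩,
            (Generated.refl _).weaken subset_rfl (by simpa using hp)⟩
        | modular₁ p q r s a b hpq => exact probCovaluation_modular₁' P hpq hC
        | modular₂ p q r s a b hpq => exact probCovaluation_modular₂' P hpq hC
      | one_lt p a hp =>
        obtain ⟨⟨q, b⟩, hq, h1, h2⟩ := hC _ (Finset.mem_singleton_self _)
        exact ⟨∅, by simp [precU], (Generated.ax (.one_lt q b (hp.trans h1))).weaken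
          subset_rfl (by simpa using hq)⟩
      | lt_one p hp =>
        obtain ⟨q, h1, h2⟩ := exists_between hp
        exact ⟨{⟨q, ⊥⟩}, fun x hx => ⟨_, Finset.mem_singleton_self _, by
            rw [Finset.mem_singleton.1 hx]; exact ⟨h1, H.bot_left _⟩⟩,
          (Generated.ax (.lt_one q h2)).weaken subset_rfl (by simp)⟩)

end Axioms

end Relations

end StrongProx

namespace StrongProx

open scoped Classical

variable {G G' G₁ G₂ : Type*}

/-! All three isomorphisms are one relabelling of generators, `⟨p, a⟩ ↦ ⟨1 - p, a⟩`. Read `⟨p, a⟩`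
as `p < μ(a)` for valuations and as `ν(a) < p` for covaluations. Then `ν(a) < p` says `1 - p < (1 -
ν)(a)`, and `1 - ν` is a probabilistic valuation exactly when `ν` is a probabilistic covaluation.
For the duals, `a ↦ 1 - μ(a)` is a valuation on the opposite lattice, and reversing `⊢` accounts for
passing from `p < μ(a)` to its negation.

In syntactic terms, the relabelling carries each axiom of one presentation to an axiom of the other
(with its two sides exchanged in the dual cases) and matches the relations `≺`. It therefore
identifies the generated entailment relations: `ProbCovaluationAx.reflect`,
`ProbValuationAx.reflect` and the two `reflect_dual` lemmas, transported by `Generated.image`.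

The rest is general: `SContEnt.isInversePair_of_equiv` turns such a bijection into mutually inverse
morphisms. Once relabelled, every composition law there becomes the single identity `≪ · ≪ = ≪`
(`cutComp_ll_ll`), whose harder half is cut elimination for `U*`, via `IsEntailmentRel.cut_star`. -/

/-! ### Iterated cuts in an entailment relation -/

theorem IsEntailmentRel.weaken {ent : Finset G → Finset G → Prop} (h : IsEntailmentRel ent)
    {A A' B B' : Finset G} (hAB : ent A B) (hA : A ⊆ A') (hB : B ⊆ B') : ent A' B' := by
  have := h.mono A' B' hAB
  rwa [Finset.union_eq_left.2 hA, Finset.union_eq_right.2 hB] at this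

theorem IsEntailmentRel.of_mem {ent : Finset G → Finset G → Prop} (h : IsEntailmentRel ent)
    {A B : Finset G} {a : G} (hA : a ∈ A) (hB : a ∈ B) : ent A B :=
  h.weaken (h.refl a) (by simpa using hA) (by simpa using hB)

theorem IsEntailmentRel.cut_finset {ent : Finset G → Finset G → Prop} (h : IsEntailmentRel ent)
    {A B : Finset G} (D : Finset G) (h₁ : ∀ d ∈ D, ent A (B ∪ {d})) (h₂ : ent (D ∪ A) B) :
    ent A B := by
  induction D using Finset.induction_on with
  | empty => simpa using h₂
  | @insert d D _ ih =>
    refine ih (fun d' hd' => h₁ d' (Finset.mem_insert_of_mem hd')) (h.cut d ?_ ?_)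
    · exact h.weaken (h₁ d (Finset.mem_insert_self _ _)) Finset.subset_union_right subset_rfl
    · exact h.weaken h₂ (by intro x; simp) subset_rfl

/-- This is distributivity: the disjunction over `D ∈ W` of the conjunctions `⋀ D` equals the
conjunction over `F ∈ W*` of the disjunctions `⋁ F`. The first hypothesis puts `A` below that
element joined with `C`, and the second puts each `⋀ D` below `C`. -/
theorem IsEntailmentRel.cut_star {ent : Finset G → Finset G → Prop} (h : IsEntailmentRel ent)
    {A C : Finset G} (W : Finset (Finset G)) (h₁ : ∀ F, Star W F → ent A (F ∪ C))
    (h₂ : ∀ D ∈ W, ent D C) : ent A C := by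
  induction W using Finset.induction_on with
  | empty => simpa using h₁ ∅ Star.empty
  | @insert D W _ ih =>
    refine ih (fun F hF => h.cut_finset D (fun d hd => ?_) ?_)
      fun D' hD' => h₂ D' (Finset.mem_insert_of_mem hD')
    -- Adding any single `d ∈ D` to `F ∈ W*` gives a member of `(insert D W)*`, so every element of
    -- `D` is available as a cut formula over `F ∪ C`.
    · have hs : Star (insert D W) (F ∪ {d}) := by
        rw [star_iff] at hF ⊢
        refine ⟨fun b hb => ?_, fun A' hA' => ?_⟩
        · rcases Finset.mem_union.1 hb with hb | hb
          · obtain ⟨A', hA', hbA⟩ := hF.1 b hb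
            exact ⟨A', Finset.mem_insert_of_mem hA', hbA⟩
          · exact ⟨D, Finset.mem_insert_self _ _, Finset.mem_singleton.1 hb ▸ hd⟩
        · rcases Finset.mem_insert.1 hA' with rfl | hA'
          · exact ⟨d, hd, by simp⟩
          · obtain ⟨a, ha, haF⟩ := hF.2 A' hA'
            exact ⟨a, ha, Finset.mem_union_left _ haF⟩
      exact h.weaken (h₁ _ hs) subset_rfl (by intro x; simp only [Finset.mem_union]; tauto)
    · exact h.weaken (h₂ D (Finset.mem_insert_self _ _)) Finset.subset_union_left
        Finset.subset_union_right

/-! ### The relation `≪` is idempotent under cut composition -/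

namespace SContEnt

variable (X : SContEnt G)

theorem ll_mono {A A' B B' : Finset G} (h : X.ll A B) (hA : A ⊆ A') (hB : B ⊆ B') :
    X.ll A' B' := by
  obtain ⟨D, h₁, h₂⟩ := h
  refine ⟨D, fun d hd => ?_, X.isEntailmentRel.weaken h₂ subset_rfl hB⟩
  obtain ⟨a, ha, had⟩ := h₁ d hd
  exact ⟨a, hA ha, had⟩

theorem ll_of_prec {A B : Finset G} {a b : G} (ha : a ∈ A) (hb : b ∈ B) (h : X.prec a b) :
    X.ll A B :=
  ⟨{b}, fun x hx => ⟨a, ha, by rwa [Finset.mem_singleton.1 hx]⟩,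
    X.isEntailmentRel.of_mem (Finset.mem_singleton_self b) hb⟩

/-- Here the other form of `≪`, namely `⊢` followed by `≺_L`, is the useful one: the two `≺_L` steps
merge because `≺` is transitive. -/
theorem ll_precL {A B C : Finset G} (h : X.ll A B) (hBC : precL X.prec B C) : X.ll A C := by
  obtain ⟨D, h₁, h₂⟩ := (X.cont A B).1 h
  refine (X.cont A C).2 ⟨D, h₁, fun d hd => ?_⟩
  obtain ⟨b, hb, hdb⟩ := h₂ d hd
  obtain ⟨c, hc, hbc⟩ := hBC b hb
  exact ⟨c, hc, (X.idem d c).2 ⟨b, hdb, hbc⟩⟩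

theorem precU_interpolate {A C : Finset G} (h : precU X.prec A C) :
    ∃ B, precU X.prec A B ∧ precU X.prec B C := by
  have h' : ∀ c : C, ∃ b, (∃ a ∈ A, X.prec a b) ∧ X.prec b c := fun c => by
    obtain ⟨a, ha, hac⟩ := h c c.2
    obtain ⟨b, hab, hbc⟩ := (X.idem _ _).1 hac
    exact ⟨b, ⟨a, ha, hab⟩, hbc⟩
  choose f hf hf' using h'
  refine ⟨C.attach.image f, fun b hb => ?_, fun c hc => ?_⟩
  · obtain ⟨c, _, rfl⟩ := Finset.mem_image.1 hb
    exact hf c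
  · exact ⟨f ⟨c, hc⟩, Finset.mem_image_of_mem _ (Finset.mem_attach _ _), hf' ⟨c, hc⟩⟩

/-- Finitely many relations `A ≪ F` have a common witness. -/
theorem exists_precU_forall_ent {A : Finset G} (W : Finset (Finset G)) (h : ∀ F ∈ W, X.ll A F) :
    ∃ A', precU X.prec A A' ∧ ∀ F ∈ W, X.ent A' F := by
  have h' : ∀ F : W, ∃ A', precU X.prec A A' ∧ X.ent A' F := fun F => h F F.2
  choose f hf hf' using h'
  refine ⟨W.attach.biUnion f, fun b hb => ?_, fun F hF => ?_⟩
  · obtain ⟨F, _, hb⟩ := Finset.mem_biUnion.1 hb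
    exact hf F b hb
  · exact X.isEntailmentRel.weaken (hf' ⟨F, hF⟩)
      (Finset.subset_biUnion_of_mem f (Finset.mem_attach _ _)) subset_rfl

/-- Each `B ∈ V` is replaced by a `D` with `B ≺_U D ⊢ C`. It then remains to see that `A ≪ F` for
all `F ∈ W*`, where `W` collects these `D`; a common first step `A ≺_U A'` reduces the claim to
`cut_star` for `⊢`. -/
theorem ll_of_cutComp {A C : Finset G} (h : cutComp X.ll X.ll A C) : X.ll A C := by
  obtain ⟨V, h₁, h₂⟩ := h
  have h' : ∀ B : V, ∃ D, precU X.prec B D ∧ X.ent D C := fun B => h₂ B B.2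
  choose f hf hf' using h'
  set W := V.attach.image f with hW
  have hstar : ∀ F, Star W F → X.ll A F := by
    intro F hF
    rw [star_iff] at hF
    -- `F` meets each `f B` in some `d`, which lies above some `b ∈ B`. These `b` form a member of
    -- `V*` that is `≺_L F`.
    have : ∀ B : V, ∃ b ∈ B.1, ∃ d ∈ F, X.prec b d := fun B => by
      obtain ⟨d, hd, hdF⟩ := hF.2 (f B) (Finset.mem_image_of_mem _ (Finset.mem_attach _ _))
      obtain ⟨b, hb, hbd⟩ := hf B d hd
      exact ⟨b, hb, d, hdF, hbd⟩
    choose g hg hg' using this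
    refine X.ll_precL (h₁ (V.attach.image g) ?_) fun b hb => ?_
    · rw [star_iff]
      refine ⟨fun b hb => ?_, fun B hB => ?_⟩
      · obtain ⟨B, _, rfl⟩ := Finset.mem_image.1 hb
        exact ⟨B, B.2, hg B⟩
      · exact ⟨g ⟨B, hB⟩, hg _, Finset.mem_image_of_mem _ (Finset.mem_attach _ _)⟩
    · obtain ⟨B, _, rfl⟩ := Finset.mem_image.1 hb
      exact hg' B
  -- Members of `W*` are subsets of `⋃ W`, so there are finitely many, and one `A'` serves them all.
  obtain ⟨A', hA', hent⟩ := X.exists_precU_forall_ent ((W.biUnion id).powerset.filter (Star W))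
    fun F hF => hstar F (Finset.mem_filter.1 hF).2
  refine ⟨A', hA', X.isEntailmentRel.cut_star W (fun F hF => ?_) fun D hD => ?_⟩
  · refine X.isEntailmentRel.weaken (hent F (Finset.mem_filter.2 ⟨?_, hF⟩)) subset_rfl
      Finset.subset_union_left
    refine Finset.mem_powerset.2 fun b hb => ?_
    obtain ⟨D, hD, hbD⟩ := ((star_iff W F).1 hF).1 b hb
    exact Finset.mem_biUnion.2 ⟨D, hD, hbD⟩
  · obtain ⟨B, _, rfl⟩ := Finset.mem_image.1 hD
    exact hf' B

theorem cutComp_of_ll {A C : Finset G} (h : X.ll A C) : cutComp X.ll X.ll A C := by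
  obtain ⟨D, h₁, h₂⟩ := h
  obtain ⟨B, hAB, hBD⟩ := X.precU_interpolate h₁
  -- Members of `{B}*` are the inhabited subsets of `B`, so a single pair `a ≺ b` with `b ∈ F`
  -- already gives `A ≪ F`.
  refine ⟨{B}, fun F hF => ?_, fun B' hB' => ?_⟩
  · obtain ⟨b, hb, hbF⟩ := ((star_iff _ _).1 hF).2 B (Finset.mem_singleton_self B)
    obtain ⟨a, ha, hab⟩ := hAB b hb
    exact X.ll_of_prec ha hbF hab
  · rw [Finset.mem_singleton.1 hB']
    exact ⟨D, hBD, h₂⟩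

theorem cutComp_ll_ll : cutComp X.ll X.ll = X.ll := by
  ext A C
  exact ⟨X.ll_of_cutComp, X.cutComp_of_ll⟩

end SContEnt

/-! ### Relabelling generators along a bijection -/

theorem star_image (e : G ≃ G') (V : Finset (Finset G)) (B : Finset G) :
    Star (V.image (Finset.image e)) (B.image e) ↔ Star V B := by
  simp [star_iff]

theorem image_symm_image (e : G ≃ G') (A : Finset G) : (A.image e).image e.symm = A := by
  simp [Finset.image_image]

theorem image_image_symm (e : G ≃ G') (A : Finset G') : (A.image e.symm).image e = A := by
  simp [Finset.image_image]

/-- Cut composition is invariant under relabelling the middle set of generators. -/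
theorem cutComp_image (e : G' ≃ G) (s : Finset G → Finset G₂ → Prop)
    (r : Finset G₁ → Finset G → Prop) :
    cutComp (fun B C => s (B.image e) C) (fun A B => r A (B.image e)) = cutComp s r := by
  ext A C
  constructor
  · rintro ⟨V, h₁, h₂⟩
    refine ⟨V.image (Finset.image e), fun F hF => ?_, fun B hB => ?_⟩
    · rw [← image_image_symm e F] at hF ⊢
      exact h₁ _ ((star_image e V _).1 hF)
    · obtain ⟨B, hBV, rfl⟩ := Finset.mem_image.1 hB
      exact h₂ B hBV
  · rintro ⟨V, h₁, h₂⟩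
    refine ⟨V.image (Finset.image e.symm), fun F hF => h₁ _ ?_, fun B hB => ?_⟩
    · rw [← image_symm_image e F] at hF
      exact (star_image e.symm V _).1 hF
    · obtain ⟨B, hBV, rfl⟩ := Finset.mem_image.1 hB
      simpa only [image_image_symm] using h₂ B hBV

/-- Derivations map to derivations rule by rule, so only the axioms have to be checked. Applied to a
bijection and to its inverse, this compares two generated entailment relations. -/
theorem Generated.image {ax : Finset G → Finset G → Prop} {ax' : Finset G' → Finset G' → Prop}
    (f : G → G') (hf : ∀ A B, ax A B → ax' (A.image f) (B.image f)) {A B : Finset G}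
    (h : Generated ax A B) : Generated ax' (A.image f) (B.image f) := by
  induction h with
  | ax h => exact .ax (hf _ _ h)
  | refl a => simpa using Generated.refl (f a)
  | mono A' B' _ ih => simpa only [Finset.image_union] using ih.mono (A'.image f) (B'.image f)
  | cut a _ _ ih ih' =>
    simp only [Finset.image_union, Finset.image_singleton] at ih ih'
    exact .cut (f a) ih ih'

namespace SContEnt

/-- A bijection of the generators that preserves and reflects `⊢` and `≺` induces mutually inverse
isomorphisms. -/
theorem isInversePair_of_equiv (X : SContEnt G) (Y : SContEnt G') (e : G' ≃ G)
    (hent : ∀ A B, Y.ent A B ↔ X.ent (A.image e) (B.image e))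
    (hprec : ∀ a b, Y.prec a b ↔ X.prec (e a) (e b)) :
    IsInversePair X Y (fun A B => X.ll A (B.image e)) (fun B A => Y.ll B (A.image e.symm)) := by
  have hprecU : ∀ A B, precU Y.prec A B ↔ precU X.prec (A.image e) (B.image e) := fun A B => by
    simp [precU, hprec]
  have hll : ∀ A B, Y.ll A B ↔ X.ll (A.image e) (B.image e) := fun A B => by
    constructor
    · rintro ⟨D, h₁, h₂⟩
      exact ⟨D.image e, (hprecU _ _).1 h₁, (hent _ _).1 h₂⟩
    · rintro ⟨D, h₁, h₂⟩
      refine ⟨D.image e.symm, (hprecU _ _).2 ?_, (hent _ _).2 ?_⟩ <;>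
        rwa [image_image_symm]
  -- With `Y.ll` and the inverse both expressed through `X.ll`, every composition law becomes `X.ll
  -- · X.ll = X.ll` up to relabelling; `cutComp_image` handles the cases where the middle set is
  -- `G'`.
  have hY : Y.ll = fun A B => X.ll (A.image e) (B.image e) := by
    ext A B
    exact hll A B
  have hs : (fun B A => Y.ll B (A.image e.symm)) = fun B A => X.ll (B.image e) A := by
    ext B A
    rw [hll, image_image_symm]
  have hX : ∀ A C, cutComp X.ll X.ll A C ↔ X.ll A C := fun A C => by rw [X.cutComp_ll_ll]
  rw [hs]
  refine ⟨⟨⟨?_, ?_, ?_⟩, ?_⟩, ⟨⟨?_, ?_, ?_⟩, ?_⟩, ?_, ?_⟩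
  · intro A A' B B' h
    exact X.ll_mono h Finset.subset_union_left (Finset.image_subset_image Finset.subset_union_left)
  · rw [hY]
    ext A C
    exact (iff_of_eq (congrFun (congrFun
      (cutComp_image e (fun B (C : Finset G') => X.ll B (C.image e)) X.ll) A) C)).trans (hX _ _)
  · ext A C
    exact hX A (C.image e)
  · intro A B h
    obtain ⟨D, h₁, h₂⟩ := (X.cont _ _).1 h
    -- A set meeting every singleton `{d}` with `d ∈ D` contains `D`, so join preservation follows
    -- from the form `A ⊢ D ≺_L B` of `≪`.
    refine ⟨D.image fun d => {d}, fun A' hA' F hF => ?_, fun A' hA' => ?_⟩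
    · rw [Finset.mem_singleton.1 hA']
      refine X.isEntailmentRel.weaken h₁ subset_rfl fun d hd => ?_
      obtain ⟨a, ha, haF⟩ := ((star_iff _ _).1 hF).2 {d} (Finset.mem_image_of_mem _ hd)
      rwa [Finset.mem_singleton.1 ha] at haF
    · obtain ⟨d, hd, rfl⟩ := Finset.mem_image.1 hA'
      obtain ⟨b', hb', hdb⟩ := h₂ d hd
      obtain ⟨b, hb, rfl⟩ := Finset.mem_image.1 hb'
      exact ⟨b, hb, X.ll_of_prec (Finset.mem_singleton_self d) (by simp) hdb⟩
  · intro B B' A A' h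
    exact X.ll_mono h (Finset.image_subset_image Finset.subset_union_left) Finset.subset_union_left
  · ext B A
    exact hX (B.image e) A
  · rw [hY]
    ext B A
    exact (iff_of_eq (congrFun (congrFun
      (cutComp_image e X.ll (fun (B : Finset G') C => X.ll (B.image e) C)) B) A)).trans (hX _ _)
  · intro B A h
    -- Join preservation of the inverse concerns `⊢` in `Y`, so the relation is pulled back to
    -- `Y.ll` before it is factored.
    rw [← image_image_symm e A] at h
    obtain ⟨D, h₁, h₂⟩ := (Y.cont _ _).1 ((hll _ _).2 h)
    refine ⟨D.image fun d => {d}, fun A' hA' F hF => ?_, fun A' hA' => ?_⟩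
    · rw [Finset.mem_singleton.1 hA']
      refine Y.isEntailmentRel.weaken h₁ subset_rfl fun d hd => ?_
      obtain ⟨a, ha, haF⟩ := ((star_iff _ _).1 hF).2 {d} (Finset.mem_image_of_mem _ hd)
      rwa [Finset.mem_singleton.1 ha] at haF
    · obtain ⟨d, hd, rfl⟩ := Finset.mem_image.1 hA'
      obtain ⟨b', hb', hdb⟩ := h₂ d hd
      obtain ⟨b, hb, rfl⟩ := Finset.mem_image.1 hb'
      refine ⟨b, hb, X.ll_of_prec (a := e d) (b := b) (by simp) (by simp) ?_⟩
      simpa [hprec] using hdb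
  · rw [cutComp_image e X.ll X.ll, X.cutComp_ll_ll]
  · rw [hY]
    ext B C
    exact hX (B.image e) (C.image e)

end SContEnt

/-! ### Reflection `p ↦ 1 - p` and the axioms -/

section Reflection

variable {S T : Type*}

/-- `⟨p, a⟩ ↦ ⟨1 - p, φ a⟩` for a bijection `φ`. -/
def reflectEquiv (φ : S ≃ T) : ValGen S ≃ ValGen T where
  toFun g := ⟨1 - g.rat, φ g.elt⟩
  invFun g := ⟨1 - g.rat, φ.symm g.elt⟩
  left_inv g := by simp
  right_inv g := by simp

variable [DistribLattice S] [BoundedOrder S] [DistribLattice T] [BoundedOrder T]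

/-- Reflection exchanges the bounds `0` and `1`, so normalisation axioms of the basic systems trade
places with the probabilistic ones: `neg` with `one_lt`, and `top` or `bot` with `lt_one`. The
modular condition survives because both sums have two terms. -/
theorem ProbCovaluationAx.reflect {A B : Finset (ValGen S)} (h : ProbCovaluationAx A B) :
    ProbValuationAx (A.image (reflectEquiv (.refl S))) (B.image (reflectEquiv (.refl S))) := by
  rcases h with ⟨h⟩ | ⟨p, a, hp⟩ | ⟨p, hp⟩
  · rcases h with ⟨p, a, hp⟩ | ⟨p, hp⟩ | ⟨p, q, a, b, hpq, hab⟩ | ⟨p, q, r, s, a, b, h⟩ |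
      ⟨p, q, r, s, a, b, h⟩ <;>
      simp only [Finset.image_insert, Finset.image_singleton, Finset.image_empty]
    · exact .one_lt _ _ (by linarith)
    · exact .lt_one _ (by linarith)
    · exact .val (.mono _ _ _ _ (by linarith) hab)
    · exact .val (.modular₁ _ _ _ _ a b (by linarith))
    · exact .val (.modular₂ _ _ _ _ a b (by linarith))
  · simp only [Finset.image_singleton, Finset.image_empty]
    exact .val (.neg _ _ (by linarith))
  · simp only [Finset.image_singleton, Finset.image_empty]
    exact .val (.bot _ (by linarith))

theorem ProbValuationAx.reflect {A B : Finset (ValGen S)} (h : ProbValuationAx A B) :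
    ProbCovaluationAx (A.image (reflectEquiv (.refl S))) (B.image (reflectEquiv (.refl S))) := by
  rcases h with ⟨h⟩ | ⟨p, a, hp⟩ | ⟨p, hp⟩
  · rcases h with ⟨p, a, hp⟩ | ⟨p, hp⟩ | ⟨p, q, a, b, hpq, hab⟩ | ⟨p, q, r, s, a, b, h⟩ |
      ⟨p, q, r, s, a, b, h⟩ <;>
      simp only [Finset.image_insert, Finset.image_singleton, Finset.image_empty]
    · exact .one_lt _ _ (by linarith)
    · exact .lt_one _ (by linarith)
    · exact .coval (.mono _ _ _ _ (by linarith) hab)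
    · exact .coval (.modular₁ _ _ _ _ a b (by linarith))
    · exact .coval (.modular₂ _ _ _ _ a b (by linarith))
  · simp only [Finset.image_singleton, Finset.image_empty]
    exact .coval (.neg _ _ (by linarith))
  · simp only [Finset.image_singleton, Finset.image_empty]
    exact .coval (.top _ (by linarith))

/-- Stated for an arbitrary `φ` so that it covers both directions of the relabelling: from `Sᵒᵈ` to
`S` with the identity, and back with `OrderIso.dualDual S`. -/
theorem ProbValuationAx.reflect_dual (φ : S ≃o Tᵒᵈ) {A B : Finset (ValGen S)}
    (h : ProbValuationAx A B) :
    ProbValuationAx (B.image (reflectEquiv (φ.toEquiv.trans OrderDual.ofDual)))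
      (A.image (reflectEquiv (φ.toEquiv.trans OrderDual.ofDual))) := by
  have hmono : ∀ {a b}, a ≤ b → OrderDual.ofDual (φ b) ≤ OrderDual.ofDual (φ a) :=
    fun h => φ.monotone h
  rcases h with ⟨h⟩ | ⟨p, a, hp⟩ | ⟨p, hp⟩
  · rcases h with ⟨p, a, hp⟩ | ⟨p, hp⟩ | ⟨p, q, a, b, hpq, hab⟩ | ⟨p, q, r, s, a, b, h⟩ |
      ⟨p, q, r, s, a, b, h⟩ <;>
      simp only [Finset.image_insert, Finset.image_singleton, Finset.image_empty, reflectEquiv,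
        Equiv.coe_fn_mk, Equiv.trans_apply, RelIso.coe_fn_toEquiv, map_inf, map_sup, map_bot,
        OrderDual.ofDual_bot, ofDual_inf, ofDual_sup]
    · exact .one_lt _ _ (by linarith)
    · exact .lt_one _ (by linarith)
    · exact .val (.mono _ _ _ _ (by linarith) (hmono hab))
    -- Order reversal swaps meet and join, so the pair carrying them must be reordered. The two
    -- modular axioms trade roles because the sides of the entailment are exchanged.
    · rw [Finset.pair_comm]
      exact .val (.modular₂ _ _ _ _ _ _ (by linarith))
    · rw [Finset.pair_comm (ValGen.mk (1 - r) _)]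
      exact .val (.modular₁ _ _ _ _ _ _ (by linarith))
  · simp only [Finset.image_singleton, Finset.image_empty]
    exact .val (.neg _ _ (by simp; linarith))
  · simp only [Finset.image_singleton, Finset.image_empty, reflectEquiv, Equiv.coe_fn_mk,
      Equiv.trans_apply, RelIso.coe_fn_toEquiv, map_top, OrderDual.ofDual_top]
    exact .val (.bot _ (by linarith))

theorem ProbCovaluationAx.reflect_dual (φ : S ≃o Tᵒᵈ) {A B : Finset (ValGen S)}
    (h : ProbCovaluationAx A B) :
    ProbCovaluationAx (B.image (reflectEquiv (φ.toEquiv.trans OrderDual.ofDual)))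
      (A.image (reflectEquiv (φ.toEquiv.trans OrderDual.ofDual))) := by
  have hmono : ∀ {a b}, a ≤ b → OrderDual.ofDual (φ b) ≤ OrderDual.ofDual (φ a) :=
    fun h => φ.monotone h
  rcases h with ⟨h⟩ | ⟨p, a, hp⟩ | ⟨p, hp⟩
  · rcases h with ⟨p, a, hp⟩ | ⟨p, hp⟩ | ⟨p, q, a, b, hpq, hab⟩ | ⟨p, q, r, s, a, b, h⟩ |
      ⟨p, q, r, s, a, b, h⟩ <;>
      simp only [Finset.image_insert, Finset.image_singleton, Finset.image_empty, reflectEquiv,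
        Equiv.coe_fn_mk, Equiv.trans_apply, RelIso.coe_fn_toEquiv, map_inf, map_sup, map_top,
        OrderDual.ofDual_top, ofDual_inf, ofDual_sup]
    · exact .one_lt _ _ (by linarith)
    · exact .lt_one _ (by linarith)
    · exact .coval (.mono _ _ _ _ (by linarith) (hmono hab))
    · rw [Finset.pair_comm]
      exact .coval (.modular₂ _ _ _ _ _ _ (by linarith))
    · rw [Finset.pair_comm (ValGen.mk (1 - r) _)]
      exact .coval (.modular₁ _ _ _ _ _ _ (by linarith))
  · simp only [Finset.image_singleton, Finset.image_empty]
    exact .coval (.neg _ _ (by simp; linarith))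
  · simp only [Finset.image_singleton, Finset.image_empty, reflectEquiv, Equiv.coe_fn_mk,
      Equiv.trans_apply, RelIso.coe_fn_toEquiv, map_bot, OrderDual.ofDual_bot]
    exact .coval (.top _ (by linarith))

/-! ### The three isomorphisms -/

/-- Reflection over the identity of `S` is its own inverse and acts on finite sets as `reflect`, so
the two relations supplied by `isInversePair_of_equiv` are definitionally the ones required. -/
theorem probValuation_isInversePair_probCovaluation (P : StrongProximityLattice S) :
    SContEnt.IsInversePair (probValuation P) (probCovaluation P)
      (fun A B => (probValuation P).ll A (reflect B))
      (fun B A => (probCovaluation P).ll B (reflect A)) := by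
  refine SContEnt.isInversePair_of_equiv _ _ (reflectEquiv (.refl S)) (fun A B => ?_)
    fun a b => ?_
  · refine ⟨fun h => h.image _ fun _ _ => ProbCovaluationAx.reflect, fun h => ?_⟩
    have := h.image (reflectEquiv (.refl S)).symm fun _ _ => ProbValuationAx.reflect
    rwa [image_symm_image, image_symm_image] at this
  · exact and_congr (sub_lt_sub_iff_left 1).symm Iff.rfl

theorem probValuation_dual_isomorphic (P : StrongProximityLattice S) :
    SContEnt.Isomorphic (probValuation P).dual (probValuation P.dual) := by
  refine ⟨_, _, SContEnt.isInversePair_of_equiv _ _ (reflectEquiv OrderDual.ofDual)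
    (fun A B => ?_) fun a b => ?_⟩
  · constructor
    -- The reflected axioms have their sides exchanged, so the image is a derivation in the opposite
    -- system; `swap` turns it into one in the original system, read backwards as the dual demands.
    · exact fun h => (Generated.image (ax := ProbValuationAx)
        (ax' := fun A B => ProbValuationAx B A) (reflectEquiv OrderDual.ofDual) (fun _ _ h =>
          ProbValuationAx.reflect_dual (.refl Sᵒᵈ) h) h).swap
    · intro h
      have := (Generated.image (ax := ProbValuationAx) (ax' := fun A B => ProbValuationAx B A)
        (reflectEquiv OrderDual.ofDual).symm (fun _ _ h =>
          ProbValuationAx.reflect_dual (OrderIso.dualDual S) h) h).swap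
      rwa [image_symm_image, image_symm_image] at this
  · exact and_congr (sub_lt_sub_iff_left 1).symm Iff.rfl

theorem probCovaluation_dual_isomorphic (P : StrongProximityLattice S) :
    SContEnt.Isomorphic (probCovaluation P).dual (probCovaluation P.dual) := by
  refine ⟨_, _, SContEnt.isInversePair_of_equiv _ _ (reflectEquiv OrderDual.ofDual)
    (fun A B => ?_) fun a b => ?_⟩
  · constructor
    · exact fun h => (Generated.image (ax := ProbCovaluationAx)
        (ax' := fun A B => ProbCovaluationAx B A) (reflectEquiv OrderDual.ofDual) (fun _ _ h =>
          ProbCovaluationAx.reflect_dual (.refl Sᵒᵈ) h) h).swap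
    · intro h
      have := (Generated.image (ax := ProbCovaluationAx) (ax' := fun A B => ProbCovaluationAx B A)
        (reflectEquiv OrderDual.ofDual).symm (fun _ _ h =>
          ProbCovaluationAx.reflect_dual (OrderIso.dualDual S) h) h).swap
      rwa [image_symm_image, image_symm_image] at this
  · exact and_congr (sub_lt_sub_iff_left 1).symm Iff.rfl

end Reflection

end StrongProx

theorem mainTheorem11 {S : Type*} [DistribLattice S] [BoundedOrder S]
    (P : StrongProx.StrongProximityLattice S) :
    StrongProx.SContEnt.IsInversePair
      (StrongProx.probValuation P) (StrongProx.probCovaluation P)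
      (fun A B => (StrongProx.probValuation P).ll A (StrongProx.reflect B))
      (fun B A => (StrongProx.probCovaluation P).ll B (StrongProx.reflect A)) ∧
    StrongProx.SContEnt.Isomorphic
      (StrongProx.probValuation P).dual (StrongProx.probValuation P.dual) ∧
    StrongProx.SContEnt.Isomorphic
      (StrongProx.probCovaluation P).dual (StrongProx.probCovaluation P.dual) :=
  ⟨StrongProx.probValuation_isInversePair_probCovaluation P,
    StrongProx.probValuation_dual_isomorphic P, StrongProx.probCovaluation_dual_isomorphic P⟩
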